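/- Let $R$ be a commutative ring with unity such that $R=2R$, let $n\ge 2$, and let $\phi$ be a skew-symmetric $2n\times 2n$ matrix over $R$ of Pfaffian $1$ (so $\phi$ is invertible). Put $$\mathrm{Sp}_\phi(R)=\{\alpha\in \mathrm{GL}_{2n}(R) : \alpha^t\phi\alpha=\phi\}.$$ Write $$\phi=\begin{pmatrix}0&-c^t\\ c&\nu\end{pmatrix},\qquad \phi^{-1}=\begin{pmatrix}0&d^t\\ -d&\mu\end{pmatrix},\qquad c,d\in R^{2n-1},$$ and for $v\in R^{2n-1}$ set $$C_\phi(v)=\begin{pmatrix}1&0\\ v& I_{2n-1}+d v^t\nu\end{pmatrix},\qquad R_\phi(v)=\begin{pmatrix}1&v^t\\ 0& I_{2n-1}+\mu v c^t\end{pmatrix}.$$ Let $\mathrm{ESp}_\phi(R)$ be the group generated by all $C_\phi(v)$ and $R_\phi(v)$ with $v\in R^{2n-1}$. Then $\mathrm{ESp}_\phi(R)$ is a normal subgroup of $\mathrm{Sp}_\phi(R)$. -/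

import Mathlib

open Matrix

namespace AltForm

/-- The Pfaffian of a matrix, by expansion along the first row:
`Pf A = ∑_{j ≥ 1} (-1)^(j-1) a_{0 j} Pf A_{0 j}` with rows and columns numbered from `0`, where
`A_{0 j}` is `A` without the rows and columns `0` and `j`. It is `1` for the empty matrix. Only its
values at alternating matrices of even size are of interest. -/
def pfaffian {R : Type*} [CommRing R] : (m : ℕ) → Matrix (Fin m) (Fin m) R → R
  | 0, _ => 1
  | 1, _ => 0
  | m + 2, A => ∑ j : Fin (m + 1), (-1) ^ (j : ℕ) * A 0 j.succ *
      pfaffian m (A.submatrix (fun i => (j.succAbove i).succ) (fun i => (j.succAbove i).succ))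

variable {R : Type*} [CommRing R] {k : ℕ}

/-- The symplectic group of `φ`: all invertible `α` with `αᵗ φ α = φ`. -/
def Sp {m : ℕ} (φ : Matrix (Fin m) (Fin m) R) : Subgroup (GL (Fin m) R) where
  carrier := {α | (α : Matrix (Fin m) (Fin m) R)ᵀ * φ * (α : Matrix (Fin m) (Fin m) R) = φ}
  mul_mem' := by
    intro a b ha hb
    simp only [Set.mem_ofPred_eq, Units.val_mul, Matrix.transpose_mul] at ha hb ⊢
    calc _ = (b : Matrix (Fin m) (Fin m) R)ᵀ * ((a : Matrix (Fin m) (Fin m) R)ᵀ * φ *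
            (a : Matrix (Fin m) (Fin m) R)) * (b : Matrix (Fin m) (Fin m) R) := by
          simp only [Matrix.mul_assoc]
      _ = φ := by rw [ha, hb]
  one_mem' := by simp
  inv_mem' := by
    intro a ha
    simp only [Set.mem_ofPred_eq] at ha ⊢
    have h1 : (a : Matrix (Fin m) (Fin m) R) * ((a⁻¹ : GL (Fin m) R) : Matrix (Fin m) (Fin m) R) = 1 :=
      Units.mul_inv a
    have h2 : ((a⁻¹ : GL (Fin m) R) : Matrix (Fin m) (Fin m) R)ᵀ *
        (a : Matrix (Fin m) (Fin m) R)ᵀ = 1 := by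
      rw [← Matrix.transpose_mul, h1, Matrix.transpose_one]
    calc _ = ((a⁻¹ : GL (Fin m) R) : Matrix (Fin m) (Fin m) R)ᵀ *
            ((a : Matrix (Fin m) (Fin m) R)ᵀ * φ * (a : Matrix (Fin m) (Fin m) R)) *
            ((a⁻¹ : GL (Fin m) R) : Matrix (Fin m) (Fin m) R) := by rw [ha]
      _ = (((a⁻¹ : GL (Fin m) R) : Matrix (Fin m) (Fin m) R)ᵀ *
            (a : Matrix (Fin m) (Fin m) R)ᵀ) * φ *
            ((a : Matrix (Fin m) (Fin m) R) *
              ((a⁻¹ : GL (Fin m) R) : Matrix (Fin m) (Fin m) R)) := by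
          simp only [Matrix.mul_assoc]
      _ = φ := by rw [h1, h2, Matrix.one_mul, Matrix.mul_one]

/-- The block matrix with first row `(a, uᵗ)` and remaining rows `(w, M)`. -/
def border (a : R) (u w : Fin k → R) (M : Matrix (Fin k) (Fin k) R) :
    Matrix (Fin (k + 1)) (Fin (k + 1)) R :=
  Matrix.of (Fin.cons (Fin.cons a u) fun i => Fin.cons (w i) (M i))

/-- The column `c` in `φ = (0, -cᵗ; c, ν)`. -/
def cVec (φ : Matrix (Fin (k + 1)) (Fin (k + 1)) R) : Fin k → R := fun i => φ i.succ 0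

/-- The block `ν` in `φ = (0, -cᵗ; c, ν)`. -/
def nuMat (φ : Matrix (Fin (k + 1)) (Fin (k + 1)) R) : Matrix (Fin k) (Fin k) R :=
  φ.submatrix Fin.succ Fin.succ

/-- The column `d` in `φ⁻¹ = (0, dᵗ; -d, μ)`. -/
noncomputable def dVec (φ : Matrix (Fin (k + 1)) (Fin (k + 1)) R) : Fin k → R :=
  fun i => φ⁻¹ 0 i.succ

/-- The block `μ` in `φ⁻¹ = (0, dᵗ; -d, μ)`. -/
noncomputable def muMat (φ : Matrix (Fin (k + 1)) (Fin (k + 1)) R) : Matrix (Fin k) (Fin k) R :=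
  φ⁻¹.submatrix Fin.succ Fin.succ

/-- `α_φ(v) = I + d vᵗ ν`. -/
noncomputable def alphaMat (φ : Matrix (Fin (k + 1)) (Fin (k + 1)) R) (v : Fin k → R) :
    Matrix (Fin k) (Fin k) R :=
  1 + vecMulVec (dVec φ) v * nuMat φ

/-- `β_φ(v) = I + μ v cᵗ`. -/
noncomputable def betaMat (φ : Matrix (Fin (k + 1)) (Fin (k + 1)) R) (v : Fin k → R) :
    Matrix (Fin k) (Fin k) R :=
  1 + muMat φ * vecMulVec v (cVec φ)

/-- `C_φ(v) = (1, 0; v, α_φ(v))`. -/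
noncomputable def CMat (φ : Matrix (Fin (k + 1)) (Fin (k + 1)) R) (v : Fin k → R) :
    Matrix (Fin (k + 1)) (Fin (k + 1)) R :=
  border 1 0 v (alphaMat φ v)

/-- `R_φ(v) = (1, vᵗ; 0, β_φ(v))`. -/
noncomputable def RMat (φ : Matrix (Fin (k + 1)) (Fin (k + 1)) R) (v : Fin k → R) :
    Matrix (Fin (k + 1)) (Fin (k + 1)) R :=
  border 1 v 0 (betaMat φ v)

/-- The elementary symplectic group of `φ`: the group generated by all `C_φ(v)` and `R_φ(v)`. For
invertible alternating `φ` these matrices are all invertible (see `isUnit_CMat`, `isUnit_RMat`). -/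
noncomputable def ESp (φ : Matrix (Fin (k + 1)) (Fin (k + 1)) R) :
    Subgroup (GL (Fin (k + 1)) R) :=
  Subgroup.closure {g | (∃ v : Fin k → R, (g : Matrix (Fin (k + 1)) (Fin (k + 1)) R) = CMat φ v) ∨
    ∃ v : Fin k → R, (g : Matrix (Fin (k + 1)) (Fin (k + 1)) R) = RMat φ v}

lemma border_mul (a a' : R) (u w u' w' : Fin k → R) (M M' : Matrix (Fin k) (Fin k) R) :
    border a u w M * border a' u' w' M' =
      border (a * a' + u ⬝ᵥ w') (a • u' + u ᵥ* M') (a' • w + M *ᵥ w') (vecMulVec w u' + M * M') := by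
  ext i j
  refine Fin.cases ?_ (fun i => ?_) i <;> refine Fin.cases ?_ (fun j => ?_) j <;>
    simp [border, Matrix.mul_apply, Fin.sum_univ_succ, dotProduct, vecMul, mulVec, vecMulVec_apply,
      mul_comm]

lemma border_one : border (1 : R) 0 0 (1 : Matrix (Fin k) (Fin k) R) = 1 := by
  ext i j
  refine Fin.cases ?_ (fun i => ?_) i <;> refine Fin.cases ?_ (fun j => ?_) j <;>
    simp [border, Matrix.one_apply, (Fin.succ_ne_zero _).symm]

lemma skew_dotProduct_self (h2 : IsUnit (2 : R)) {N : Matrix (Fin k) (Fin k) R} (hN : Nᵀ = -N)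
    (v : Fin k → R) : v ⬝ᵥ (N *ᵥ v) = 0 := by
  have h : v ⬝ᵥ (N *ᵥ v) = -(v ⬝ᵥ (N *ᵥ v)) := by
    conv_lhs => rw [Matrix.dotProduct_mulVec, dotProduct_comm, ← Matrix.mulVec_transpose, hN,
      Matrix.neg_mulVec, dotProduct_neg]
  have h' : (2 : R) * (v ⬝ᵥ (N *ᵥ v)) = 0 := by linear_combination h
  exact (h2.mul_right_eq_zero).1 h'

lemma skew_diag (h2 : IsUnit (2 : R)) {m : ℕ} {N : Matrix (Fin m) (Fin m) R} (hN : Nᵀ = -N)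
    (i : Fin m) : N i i = 0 := by
  have h : N i i = -N i i := by simpa using congrFun (congrFun hN i) i
  exact (h2.mul_right_eq_zero).1 (by linear_combination h : (2 : R) * N i i = 0)

lemma skew_inv {m : ℕ} {φ : Matrix (Fin m) (Fin m) R} (hφ : φᵀ = -φ) (hdet : IsUnit φ.det) :
    φ⁻¹ᵀ = -φ⁻¹ := by
  rw [Matrix.transpose_nonsing_inv, hφ]
  exact Matrix.inv_eq_right_inv (by rw [neg_mul_neg, Matrix.mul_nonsing_inv _ hdet])

lemma nuMat_mulVec_dVec (h2 : IsUnit (2 : R)) {φ : Matrix (Fin (k + 1)) (Fin (k + 1)) R}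
    (hφ : φᵀ = -φ) (hdet : IsUnit φ.det) : nuMat φ *ᵥ dVec φ = 0 := by
  have hi := skew_inv hφ hdet
  ext i
  have h := congrFun (congrFun (Matrix.mul_nonsing_inv φ hdet) i.succ) 0
  rw [Matrix.mul_apply, Fin.sum_univ_succ, skew_diag h2 hi, mul_zero, zero_add,
    Matrix.one_apply_ne (Fin.succ_ne_zero i)] at h
  have h3 : ∀ j : Fin k, φ⁻¹ 0 j.succ = -φ⁻¹ j.succ 0 := fun j => by
    simpa using congrFun (congrFun hi j.succ) 0
  simp only [mulVec, dotProduct, nuMat, dVec, Matrix.submatrix_apply, h3, mul_neg,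
    Finset.sum_neg_distrib, h, neg_zero, Pi.zero_apply]

lemma cVec_vecMul_muMat (h2 : IsUnit (2 : R)) {φ : Matrix (Fin (k + 1)) (Fin (k + 1)) R}
    (hφ : φᵀ = -φ) (hdet : IsUnit φ.det) : cVec φ ᵥ* muMat φ = 0 := by
  ext j
  have h := congrFun (congrFun (Matrix.mul_nonsing_inv φ hdet) 0) j.succ
  rw [Matrix.mul_apply, Fin.sum_univ_succ, skew_diag h2 hφ, zero_mul, zero_add,
    Matrix.one_apply_ne (Fin.succ_ne_zero j).symm] at h
  have h3 : ∀ i : Fin k, φ i.succ 0 = -φ 0 i.succ := fun i => by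
    simpa using congrFun (congrFun hφ 0) i.succ
  simp only [vecMul, dotProduct, muMat, cVec, Matrix.submatrix_apply, h3, neg_mul,
    Finset.sum_neg_distrib, h, neg_zero, Pi.zero_apply]

lemma skew_submatrix {φ : Matrix (Fin (k + 1)) (Fin (k + 1)) R} (hφ : φᵀ = -φ) :
    (φ.submatrix Fin.succ Fin.succ)ᵀ = -φ.submatrix Fin.succ Fin.succ := by
  ext i j
  simpa using congrFun (congrFun hφ i.succ) j.succ

lemma CMat_mul_neg (h2 : IsUnit (2 : R)) {φ : Matrix (Fin (k + 1)) (Fin (k + 1)) R}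
    (hφ : φᵀ = -φ) (hdet : IsUnit φ.det) (v : Fin k → R) : CMat φ v * CMat φ (-v) = 1 := by
  have e1 : alphaMat φ v *ᵥ v = v := by
    rw [alphaMat, Matrix.add_mulVec, Matrix.one_mulVec, ← Matrix.mulVec_mulVec,
      Matrix.vecMulVec_mulVec, skew_dotProduct_self (N := nuMat φ) h2 (skew_submatrix hφ)]
    simp
  have e2 : alphaMat φ v * alphaMat φ (-v) = 1 := by
    have : vecMulVec (dVec φ) v * nuMat φ * (vecMulVec (dVec φ) v * nuMat φ) = 0 := by
      rw [Matrix.mul_assoc, ← Matrix.mul_assoc (nuMat φ), Matrix.mul_vecMulVec,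
        nuMat_mulVec_dVec h2 hφ hdet]
      simp
    simp only [alphaMat, Matrix.vecMulVec_neg, Matrix.neg_mul, add_mul, mul_add, one_mul, mul_one,
      mul_neg, this]
    simp
  rw [CMat, CMat, border_mul, Matrix.mulVec_neg, e1, e2]
  simp [border_one]

lemma RMat_mul_neg (h2 : IsUnit (2 : R)) {φ : Matrix (Fin (k + 1)) (Fin (k + 1)) R}
    (hφ : φᵀ = -φ) (hdet : IsUnit φ.det) (v : Fin k → R) : RMat φ v * RMat φ (-v) = 1 := by
  have e1 : v ᵥ* betaMat φ (-v) = v := by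
    rw [betaMat, Matrix.vecMul_add, Matrix.vecMul_one, ← Matrix.vecMul_vecMul,
      Matrix.vecMul_vecMulVec, dotProduct_neg, ← Matrix.dotProduct_mulVec,
      skew_dotProduct_self (N := muMat φ) h2 (skew_submatrix (skew_inv hφ hdet))]
    simp
  have e2 : betaMat φ v * betaMat φ (-v) = 1 := by
    have : muMat φ * vecMulVec v (cVec φ) * (muMat φ * vecMulVec v (cVec φ)) = 0 := by
      rw [Matrix.mul_assoc, ← Matrix.mul_assoc (vecMulVec v (cVec φ)), Matrix.vecMulVec_mul,
        cVec_vecMul_muMat h2 hφ hdet]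
      simp
    simp only [betaMat, Matrix.neg_vecMulVec, Matrix.mul_neg, add_mul, mul_add, one_mul, mul_one,
      this]
    simp
  rw [RMat, RMat, border_mul, e1, e2]
  simp [border_one]

lemma isUnit_CMat (h2 : IsUnit (2 : R)) {φ : Matrix (Fin (k + 1)) (Fin (k + 1)) R}
    (hφ : φᵀ = -φ) (hdet : IsUnit φ.det) (v : Fin k → R) : IsUnit (CMat φ v) :=
  IsUnit.of_mul_eq_one _ (CMat_mul_neg h2 hφ hdet v)

lemma isUnit_RMat (h2 : IsUnit (2 : R)) {φ : Matrix (Fin (k + 1)) (Fin (k + 1)) R}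
    (hφ : φᵀ = -φ) (hdet : IsUnit φ.det) (v : Fin k → R) : IsUnit (RMat φ v) :=
  IsUnit.of_mul_eq_one _ (RMat_mul_neg h2 hφ hdet v)

end AltForm

/-! Write `T` for `transvec` and ⟨x, y⟩ = xᵗφy. The vectors e = e₀ and f = (0, d) form a hyperbolic
pair, and the matrices R_φ(v), C_φ(v) are exactly the T(e, w, a) with w ⊥ e and the T(f, w, a) with
w ⊥ f. An isometry g satisfies g T(v, w, a) g⁻¹ = T(gv, gw, a), so normality follows from
`transvec_mem`: T(v, w, a) is elementary as soon as v is unimodular (⟨v, z⟩ = 1 for some z) and w ⊥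
v.

To prove this, put P = {e, f}ᗮ and v = ae + bf + q with q ∈ P. Conjugating the given transvections
makes T(v, s k(p), 0) elementary for the Koszul vectors k(p) = bp - ⟨q, p⟩e, p ∈ P, when s is a
multiple of b or of ⟨q, p⟩; the mirror images under (e, f) ↦ (f, -e) follow. Commutators of these
have the form T(v, 0, c), so `longIdeal` has a, b and all ⟨q, p⟩ in its radical, and unimodularity
makes it R. Then `shortSubmodule` is a submodule, a similar argument puts the Koszul vectors
themselves into it, and w = ⟨v, z⟩w - ⟨v, w⟩z is a combination of its known members.

The assumption n ≥ 2 enters through `fullForm`; the Pfaffian serves to make φ invertible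
(`isUnit_det_of_pfaffian`). -/

open Matrix

namespace AltForm

/-! ### Identities between symplectic transvections -/

section Transvection

variable {R V : Type*} [CommRing R] [AddCommGroup V] [Module R V]

/-- The symplectic transvection `x ↦ x + ⟨v, x⟩ w + ⟨w, x⟩ v + a ⟨v, x⟩ v`. -/
def transvec (B : LinearMap.BilinForm R V) (v w : V) (a : R) : Module.End R V :=
  1 + (B v).smulRight w + (B w).smulRight v + (a • B v).smulRight v

variable {B : LinearMap.BilinForm R V}

lemma transvec_apply (v w : V) (a : R) (x : V) :
    transvec B v w a x = x + B v x • w + B w x • v + (a * B v x) • v := by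
  simp [transvec]

lemma transvec_comm (v w : V) : transvec B v w 0 = transvec B w v 0 := by
  ext x; simp only [transvec_apply]; module

lemma transvec_zero (v : V) : transvec B v 0 0 = 1 := by
  ext x; simp [transvec_apply]

lemma transvec_smul_left (v w : V) (r : R) :
    transvec B (r • v) w 0 = transvec B v (r • w) 0 := by
  ext x; simp only [transvec_apply, map_smul, LinearMap.smul_apply, smul_eq_mul]; module

lemma transvec_add_smul_self (v w : V) (s a : R) :
    transvec B v (w + s • v) a = transvec B v w (a + 2 * s) := by
  ext x
  simp only [transvec_apply, map_smul, map_add, LinearMap.add_apply, LinearMap.smul_apply,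
    smul_eq_mul]
  module

lemma transvec_neg_left (v w : V) (a : R) :
    transvec B (-v) w a = transvec B v (-w) a := by
  ext x; simp only [transvec_apply, map_neg, LinearMap.neg_apply]; module

/-- For fixed v the transvections form a Heisenberg-type group with cocycle ⟨w, w'⟩, so commutators
land among the T(v, 0, c). -/
lemma transvec_mul (hB : B.IsAlt) {v w w' : V} (h : B v w = 0) (h' : B v w' = 0) (a a' : R) :
    transvec B v w a * transvec B v w' a' = transvec B v (w + w') (a + a' + B w w') := by
  have hw : B w v = 0 := by rw [← hB.neg_eq, h, neg_zero]
  ext x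
  simp only [transvec_apply, Module.End.mul_apply, map_smul, map_add, LinearMap.add_apply,
    h', hB v, hw]
  module

lemma transvec_mul_neg (hB : B.IsAlt) {v w : V} (h : B v w = 0) (a : R) :
    transvec B v w a * transvec B v (-w) (-a) = 1 := by
  rw [transvec_mul hB h (by simp [h])]
  simp [hB w, transvec_zero]

lemma transvec_conj {g : Module.End R V} (hg : ∀ x y, B (g x) (g y) = B x y) (v w : V) (a : R) :
    g * transvec B v w a = transvec B (g v) (g w) a * g := by
  ext x
  simp [transvec_apply, hg]

lemma transvec_isometry (hB : B.IsAlt) {v w : V} (h : B v w = 0) (a : R) (x y : V) :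
    B (transvec B v w a x) (transvec B v w a y) = B x y := by
  have hw : B w v = 0 := by rw [← hB.neg_eq, h, neg_zero]
  have e1 : B x v = -B v x := (hB.neg_eq _ _).symm
  have e2 : B x w = -B w x := (hB.neg_eq _ _).symm
  simp only [transvec_apply, map_smul, map_add, LinearMap.add_apply, LinearMap.smul_apply,
    smul_eq_mul, h, hw, hB v, hB w, e1, e2]
  ring

/-- Expand c⟨x + y, z⟩(x + y): the cross terms are the middle factor. -/
lemma transvec_add_left (hB : B.IsAlt) {x y : V} (h : B x y = 0) (c : R) :
    transvec B (x + y) 0 c =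
      transvec B x 0 c * transvec B x (c • y) 0 * transvec B y 0 c := by
  have hy : B y x = 0 := by rw [← hB.neg_eq, h, neg_zero]
  ext z
  simp only [transvec_apply, Module.End.mul_apply, map_smul, map_add, LinearMap.add_apply,
    LinearMap.smul_apply, smul_eq_mul, h, hB x, hB y, map_zero, LinearMap.zero_apply]
  module

/-! ### Transvections generated by a hyperbolic pair -/

/-- A hyperbolic pair `e, f` together with a monoid of endomorphisms containing all transvections
along `e` and along `f`. -/
structure ElemPair (B : LinearMap.BilinForm R V) (e f : V) (E : Submonoid (Module.End R V)) :
    Prop where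
  alt : B.IsAlt
  pair : B f e = 1
  mem_left : ∀ w a, B e w = 0 → transvec B e w a ∈ E
  mem_right : ∀ w a, B f w = 0 → transvec B f w a ∈ E

namespace ElemPair

variable {e f : V} {E : Submonoid (Module.End R V)}

/-- The quarter turn of the hyperbolic plane: every result has a mirror image. -/
lemma symm (H : ElemPair B e f E) : ElemPair B f (-e) E where
  alt := H.alt
  pair := by rw [map_neg, LinearMap.neg_apply, H.alt.neg_eq, H.pair]
  mem_left := H.mem_right
  mem_right w a h := by
    rw [transvec_neg_left]
    exact H.mem_left _ _ (by simpa using h)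

lemma pair' (H : ElemPair B e f E) : B e f = -1 := by rw [← H.alt.neg_eq, H.pair]

lemma mem_conj (H : ElemPair B e f E) {u z v w : V} {a c : R}
    (huz : B u z = 0) (hu : ∀ w a, B u w = 0 → transvec B u w a ∈ E)
    (h : transvec B v w a ∈ E) :
    transvec B (transvec B u z c v) (transvec B u z c w) a ∈ E := by
  have h1 := transvec_conj (transvec_isometry H.alt huz c) v w a
  have h2 := transvec_mul_neg H.alt huz c
  have : transvec B (transvec B u z c v) (transvec B u z c w) a =
      transvec B u z c * transvec B v w a * transvec B u (-z) (-c) := by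
    rw [h1, mul_assoc, h2, mul_one]
  rw [this]
  exact E.mul_mem (E.mul_mem (hu _ _ huz) h) (hu _ _ (by simp [huz]))

/-- Conjugation by T(e, -p, 0) fixes q and moves f to f + p, turning T(q, f, 0) into T(q, f + p, 0);
removing T(q, f, 0) leaves T(q, p, 0). -/
lemma mem_perp (H : ElemPair B e f E) {p q : V} (hep : B e p = 0)
    (hfp : B f p = 0) (heq : B e q = 0) (hfq : B f q = 0) (hpq : B p q = 0) :
    transvec B p q 0 ∈ E := by
  have hpf : B p f = 0 := by rw [← H.alt.neg_eq, hfp, neg_zero]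
  have hqf : B q f = 0 := by rw [← H.alt.neg_eq, hfq, neg_zero]
  have hqp : B q p = 0 := by rw [← H.alt.neg_eq, hpq, neg_zero]
  have h := H.mem_conj (c := 0) (a := 0) (z := -p) (by simp [hep]) H.mem_left
    (H.mem_right q 0 hfq)
  have e1 : transvec B e (-p) 0 f = f + p := by
    simp [transvec_apply, H.pair', hpf]
  have e2 : transvec B e (-p) 0 q = q := by
    simp [transvec_apply, heq, hpq]
  rw [e1, e2, transvec_comm] at h
  have h3 := transvec_mul H.alt (v := q) (w := -f) (w' := f + p) (by simp [hqf])
    (by simp [hqf, hqp]) 0 0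
  have h4 : B (-f) (f + p) = 0 := by simp [H.alt f, hfp]
  rw [h4, neg_add_cancel_left, add_zero, add_zero] at h3
  rw [transvec_comm, ← h3]
  refine E.mul_mem ?_ h
  rw [transvec_comm, transvec_neg_left]
  exact H.mem_right _ _ (by simp [hfq])

lemma mem_perp_zero (H : ElemPair B e f E) {h : R} (h2 : 2 * h = 1) {p : V} (hep : B e p = 0)
    (hfp : B f p = 0) (c : R) : transvec B p 0 c ∈ E := by
  -- T(p, 0, c) = T(p, (c/2)p, 0), which `mem_perp` covers.
  have := transvec_add_smul_self (B := B) p 0 (h * c) 0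
  rw [zero_add, zero_add, ← mul_assoc, h2, one_mul] at this
  rw [← this]
  exact H.mem_perp hep hfp (by simp [hep]) (by simp [hfp]) (by simp [H.alt p])

lemma mem_of_perp_left (H : ElemPair B e f E) {h : R} (h2 : 2 * h = 1) {w p : V} {a b : R}
    (hew : B e w = 0) (hfw : B f w = 0) (hep : B e p = 0) (hfp : B f p = 0)
    (hwp : B w p = 0) (c : R) :
    transvec B w (a • e + b • f + p) c ∈ E := by
  have hwe : B w e = 0 := by rw [← H.alt.neg_eq, hew, neg_zero]
  have hwf : B w f = 0 := by rw [← H.alt.neg_eq, hfw, neg_zero]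
  have e1 := transvec_mul H.alt (v := w) (w := a • e) (w' := b • f) (by simp [hwe])
    (by simp [hwf]) 0 0
  have e2 := transvec_mul H.alt (v := w) (w := a • e + b • f) (w' := p) (by simp [hwe, hwf])
    hwp (0 + 0 + B (a • e) (b • f)) 0
  set s := 0 + 0 + B (a • e) (b • f) + 0 + B (a • e + b • f) p with hs
  have e3 := transvec_mul H.alt (v := w) (w := a • e + b • f + p) (w' := 0)
    (by simp [hwe, hwf, hwp]) (by simp) s (c - s)
  rw [map_zero, add_zero, add_zero, add_sub_cancel] at e3
  rw [← e3, ← e2, ← e1]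
  refine E.mul_mem (E.mul_mem (E.mul_mem ?_ ?_) ?_) ?_
  · rw [transvec_comm, transvec_smul_left]
    exact H.mem_left _ _ (by simp [hew])
  · rw [transvec_comm, transvec_smul_left]
    exact H.mem_right _ _ (by simp [hfw])
  · exact H.mem_perp hew hfw hep hfp hwp
  · exact H.mem_perp_zero h2 hew hfw _

lemma mem_add_smul_zero (H : ElemPair B e f E) {h : R} (h2 : 2 * h = 1) {p : V} (s : R)
    (hep : B e p = 0) (hfp : B f p = 0) (c : R) : transvec B (p + s • e) 0 c ∈ E := by
  have hpe : B p e = 0 := by rw [← H.alt.neg_eq, hep, neg_zero]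
  rw [transvec_add_left H.alt (by simp [hpe])]
  refine E.mul_mem (E.mul_mem (H.mem_perp_zero h2 hep hfp _) ?_) ?_
  · rw [smul_smul, transvec_comm, transvec_smul_left]
    exact H.mem_left _ _ (by simp [hep])
  · have : transvec B (s • e) 0 c = transvec B e 0 (s * s * c) := by
      ext x
      simp only [transvec_apply, map_smul, LinearMap.smul_apply, smul_eq_mul, map_zero,
        LinearMap.zero_apply]
      module
    rw [this]
    exact H.mem_left _ _ (by simp)

lemma mem_smul_zero_add (H : ElemPair B e f E) {h : R} (h2 : 2 * h = 1) {p : V} (s : R)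
    (hep : B e p = 0) (hfp : B f p = 0) (c : R) : transvec B (p + s • f) 0 c ∈ E :=
  H.symm.mem_add_smul_zero h2 s hfp (by simp [hep]) c

/-- If `T(x + y, 0, 1) ∈ E` and `T(x, 0, -1), T(y, 0, -1) ∈ E` then `T(x, y, 0) ∈ E`. -/
lemma mem_of_add (H : ElemPair B e f E) {x y : V} (hxy : B x y = 0)
    (hx : transvec B x 0 (-1) ∈ E) (hy : transvec B y 0 (-1) ∈ E)
    (h : transvec B (x + y) 0 1 ∈ E) : transvec B x y 0 ∈ E := by
  have e1 := transvec_add_left H.alt hxy 1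
  have e2 := transvec_mul_neg H.alt (v := y) (w := 0) (by simp) 1
  have e3 := transvec_mul_neg H.alt (v := x) (w := 0) (by simp) (-1)
  rw [neg_zero] at e2 e3
  rw [neg_neg] at e3
  have : transvec B x y 0 =
      transvec B x 0 (-1) * transvec B (x + y) 0 1 * transvec B y 0 (-1) := by
    rw [e1, one_smul, mul_assoc, mul_assoc, mul_assoc, e2, mul_one, ← mul_assoc, e3, one_mul]
  rw [this]
  exact E.mul_mem (E.mul_mem hx h) hy

/-- The Levi-type transvections `T(b p - t e, r t (b f + q))`, where `t = ⟨q, p⟩`. -/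
lemma mem_levi_form (H : ElemPair B e f E) {h : R} (h2 : 2 * h = 1) {p q : V} (b r : R)
    (hep : B e p = 0) (hfp : B f p = 0) (heq : B e q = 0) (hfq : B f q = 0) :
    transvec B (b • p + (-B q p) • e) ((r * B q p) • (q + b • f)) 0 ∈ E := by
  have hqe : B q e = 0 := by rw [← H.alt.neg_eq, heq, neg_zero]
  have hpf : B p f = 0 := by rw [← H.alt.neg_eq, hfp, neg_zero]
  have hpq : B p q = -B q p := (H.alt.neg_eq _ _).symm
  have hz : ∀ c, transvec B (b • p + (-B q p) • e) 0 c ∈ E :=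
    H.mem_add_smul_zero h2 _ (by simp [hep]) (by simp [hfp])
  refine H.mem_of_add ?_ (hz _) ?_ ?_
  · simp [hpq, hpf, heq, H.pair']; ring
  · rw [smul_add, smul_smul]
    exact H.mem_smul_zero_add h2 _ (by simp [heq]) (by simp [hfq]) _
  -- The parameters are chosen so that T(f, -rq, -2rb) sends x = bp - te to x + rt(q + bf).
  · have := H.mem_conj (u := f) (z := (-r) • q) (c := -2 * r * b) (by simp [hfq]) H.mem_right
      (hz 1)
    convert this using 1
    · simp only [transvec_apply, map_smul, map_add, LinearMap.smul_apply, smul_eq_mul, hfp, H.pair,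
        hqe, map_zero, zero_smul, add_zero]
      congr 1
      module

/-- The Levi-type transvections `T(q + b f, r b (b p - t e))`, where `t = ⟨q, p⟩`. -/
lemma mem_levi_coord (H : ElemPair B e f E) {h : R} (h2 : 2 * h = 1) {p q : V} (b r : R)
    (hep : B e p = 0) (hfp : B f p = 0) (heq : B e q = 0) (hfq : B f q = 0) :
    transvec B (q + b • f) ((r * b) • (b • p + (-B q p) • e)) 0 ∈ E := by
  have hqe : B q e = 0 := by rw [← H.alt.neg_eq, heq, neg_zero]
  have hpf : B p f = 0 := by rw [← H.alt.neg_eq, hfp, neg_zero]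
  have hpq : B p q = -B q p := (H.alt.neg_eq _ _).symm
  have hz : ∀ c, transvec B (q + b • f) 0 c ∈ E :=
    H.mem_smul_zero_add h2 _ (by simp [heq]) (by simp [hfq])
  refine H.mem_of_add ?_ (hz _) ?_ ?_
  · simp [hfp, hqe, H.pair]; ring
  · rw [smul_add, smul_smul, smul_smul]
    exact H.mem_add_smul_zero h2 _ (by simp [hep]) (by simp [hfp]) _
  -- Here T(e, -rbp, 2rt) sends q + bf to q + bf + rb(bp - te).
  · have := H.mem_conj (u := e) (z := (-(r * b)) • p) (c := 2 * r * B q p) (by simp [hep])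
      H.mem_left (hz 1)
    convert this using 1
    · simp only [transvec_apply, map_smul, map_add, LinearMap.smul_apply, smul_eq_mul, heq, H.pair',
        hpf, hpq, map_zero, zero_smul, add_zero]
      congr 1
      module

/-- With w = bp - ⟨q, p⟩e one has T(v, sw, 0) = T(w, sv, 0), and sv splits as sae + s(q + bf). The
first piece is elementary since w ⊥ e, the second is `hm`, and T(w, 0, -c) cancels the cocycle. -/
lemma mem_of_levi (H : ElemPair B e f E) {h : R} (h2 : 2 * h = 1) {p q : V} (a b s : R)
    (hep : B e p = 0) (hfp : B f p = 0) (heq : B e q = 0)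
    (hm : transvec B (b • p + (-B q p) • e) (s • (q + b • f)) 0 ∈ E) :
    transvec B (a • e + b • f + q) (s • (b • p + (-B q p) • e)) 0 ∈ E := by
  have hpe : B p e = 0 := by rw [← H.alt.neg_eq, hep, neg_zero]
  have hpf : B p f = 0 := by rw [← H.alt.neg_eq, hfp, neg_zero]
  have hpq : B p q = -B q p := (H.alt.neg_eq _ _).symm
  rw [transvec_comm, transvec_smul_left]
  set w := b • p + (-B q p) • e with hw
  have hwe : B w e = 0 := by simp [hw, hpe, H.alt e]
  have hwm : B w (q + b • f) = 0 := by simp [hw, hpq, hpf, heq, H.pair']; ring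
  have hew : B e w = 0 := by rw [← H.alt.neg_eq, hwe, neg_zero]
  have e1 := transvec_mul H.alt (v := w) (w := (s * a) • e) (w' := s • (q + b • f)) (by simp [hwe])
    (by rw [map_smul, hwm, smul_zero]) 0 0
  set c := 0 + 0 + B ((s * a) • e) (s • (q + b • f)) with hc
  have e2 := transvec_mul H.alt (v := w) (w := (s * a) • e + s • (q + b • f)) (w' := 0)
    (by rw [map_add, map_smul, map_smul, hwm, hwe]; simp) (by simp) c (-c)
  rw [map_zero, add_zero, add_zero, add_neg_cancel] at e2
  have e3 : s • (a • e + b • f + q) = (s * a) • e + s • (q + b • f) := by module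
  rw [e3, ← e2, ← e1]
  refine E.mul_mem (E.mul_mem ?_ hm) ?_
  · rw [transvec_comm, transvec_smul_left]
    exact H.mem_left _ _ (by simp [hew])
  · exact H.mem_add_smul_zero h2 _ (by simp [hep]) (by simp [hfp]) _

end ElemPair

end Transvection

end AltForm

namespace AltForm

/-! ### Transvections along arbitrary unimodular vectors -/

section Transvection

variable {R V : Type*} [CommRing R] [AddCommGroup V] [Module R V]

variable {B : LinearMap.BilinForm R V}

/-- The commutator of T(v, (r/2)w, 0) and T(v, w', 0): commutators double the form, and h = 1/2
undoes this. -/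
lemma mem_zero_of_mem_mem (hB : B.IsAlt) {E : Submonoid (Module.End R V)} {h : R} (h2 : 2 * h = 1)
    {v w w' : V} (hw : B v w = 0) (hw' : B v w' = 0) (hm : ∀ r : R, transvec B v (r • w) 0 ∈ E)
    (hm' : ∀ r : R, transvec B v (r • w') 0 ∈ E) (r : R) :
    transvec B v 0 (r * B w w') ∈ E := by
  have e1 := transvec_mul hB (v := v) (w := (r * h) • w) (w' := (1 : R) • w') (by simp [hw])
    (by simp [hw']) 0 0
  have e2 := transvec_mul hB (v := v) (w := (-(r * h)) • w) (w' := (-1 : R) • w') (by simp [hw])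
    (by simp [hw']) 0 0
  have e3 := transvec_mul hB (v := v) (w := (r * h) • w + (1 : R) • w')
    (w' := (-(r * h)) • w + (-1 : R) • w') (by simp [hw, hw']) (by simp [hw, hw'])
    (0 + 0 + B ((r * h) • w) ((1 : R) • w')) (0 + 0 + B ((-(r * h)) • w) ((-1 : R) • w'))
  have e4 : (r * h) • w + (1 : R) • w' + ((-(r * h)) • w + (-1 : R) • w') = 0 := by module
  have e5 : 0 + 0 + B ((r * h) • w) ((1 : R) • w') +
      (0 + 0 + B ((-(r * h)) • w) ((-1 : R) • w')) +
      B ((r * h) • w + (1 : R) • w') ((-(r * h)) • w + (-1 : R) • w') = r * B w w' := by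
    have hs : B w' w = -B w w' := (hB.neg_eq _ _).symm
    simp only [map_smul, map_add, LinearMap.add_apply, LinearMap.smul_apply, smul_eq_mul, hB w,
      hB w', hs]
    linear_combination (r * B w w') * h2
  rw [e4, e5, ← e1, ← e2] at e3
  rw [← e3]
  exact E.mul_mem (E.mul_mem (hm _) (hm' _)) (E.mul_mem (hm _) (hm' _))

namespace ElemPair

variable {e f : V} {E : Submonoid (Module.End R V)}

lemma exists_decomp (H : ElemPair B e f E) (z : V) :
    ∃ (a b : R) (p : V), B e p = 0 ∧ B f p = 0 ∧ z = a • e + b • f + p :=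
  ⟨B f z, -B e z, z - B f z • e + B e z • f, by simp [H.alt e, H.pair'], by
    simp [H.alt f, H.pair], by module⟩

lemma form_decomp (H : ElemPair B e f E) {a b a' b' : R} {p p' : V} (hep : B e p = 0)
    (hfp : B f p = 0) (hep' : B e p' = 0) (hfp' : B f p' = 0) :
    B (a • e + b • f + p) (a' • e + b' • f + p') = b * a' - a * b' + B p p' := by
  have hpe : B p e = 0 := by rw [← H.alt.neg_eq, hep, neg_zero]
  have hpf : B p f = 0 := by rw [← H.alt.neg_eq, hfp, neg_zero]
  simp [H.alt e, H.alt f, H.pair, H.pair', hpe, hpf, hep', hfp']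
  ring

section Fixed

variable {h : R} {a b : R} {q : V}

lemma mem_form_left (H : ElemPair B e f E) (h2 : 2 * h = 1) (heq : B e q = 0) (hfq : B f q = 0)
    {p : V} (hep : B e p = 0) (hfp : B f p = 0) (r : R) :
    transvec B (a • e + b • f + q) (r • B q p • (b • p + (-B q p) • e)) 0 ∈ E := by
  rw [smul_smul]
  exact H.mem_of_levi h2 a b _ hep hfp heq (H.mem_levi_form h2 b r hep hfp heq hfq)

lemma mem_coord_left (H : ElemPair B e f E) (h2 : 2 * h = 1) (heq : B e q = 0) (hfq : B f q = 0)
    {p : V} (hep : B e p = 0) (hfp : B f p = 0) (r : R) :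
    transvec B (a • e + b • f + q) (r • b • (b • p + (-B q p) • e)) 0 ∈ E := by
  rw [smul_smul]
  refine H.mem_of_levi h2 a b _ hep hfp heq ?_
  have := H.mem_levi_coord h2 b r hep hfp heq hfq
  rwa [transvec_comm, transvec_smul_left] at this

lemma symm_decomp (a b : R) (e f q : V) : a • e + b • f + q = b • f + (-a) • (-e) + q := by
  module

lemma mem_form_right (H : ElemPair B e f E) (h2 : 2 * h = 1) (heq : B e q = 0) (hfq : B f q = 0)
    {p : V} (hep : B e p = 0) (hfp : B f p = 0) (r : R) :
    transvec B (a • e + b • f + q) (r • B q p • ((-a) • p + (-B q p) • f)) 0 ∈ E := by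
  rw [symm_decomp]
  exact H.symm.mem_form_left h2 hfq (by simp [heq]) hfp (by simp [hep]) r

lemma mem_coord_right (H : ElemPair B e f E) (h2 : 2 * h = 1) (heq : B e q = 0)
    (hfq : B f q = 0) {p : V} (hep : B e p = 0) (hfp : B f p = 0) (r : R) :
    transvec B (a • e + b • f + q) (r • (-a) • ((-a) • p + (-B q p) • f)) 0 ∈ E := by
  rw [symm_decomp]
  exact H.symm.mem_coord_left h2 hfq (by simp [heq]) hfp (by simp [hep]) r

lemma perp_left (H : ElemPair B e f E) (heq : B e q = 0) {p : V}
    (hep : B e p = 0) (hfp : B f p = 0) :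
    B (a • e + b • f + q) (b • p + (-B q p) • e) = 0 := by
  have hqe : B q e = 0 := by rw [← H.alt.neg_eq, heq, neg_zero]
  simp [hep, hfp, H.pair, hqe, H.alt e]

lemma perp_right (H : ElemPair B e f E) (hfq : B f q = 0) {p : V}
    (hep : B e p = 0) (hfp : B f p = 0) :
    B (a • e + b • f + q) ((-a) • p + (-B q p) • f) = 0 := by
  rw [symm_decomp]
  exact H.symm.perp_left hfq hfp (by simp [hep])

/-- An ideal whose radical contains the coordinates of a unimodular vector is everything. -/
lemma ideal_eq_top (H : ElemPair B e f E) (heq : B e q = 0) (hfq : B f q = 0) {z : V}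
    (hz : B (a • e + b • f + q) z = 1) {I : Ideal R} (ha : a ∈ I.radical) (hb : b ∈ I.radical)
    (hI : ∀ p, B e p = 0 → B f p = 0 → B q p ∈ I.radical) : I = ⊤ := by
  obtain ⟨a', b', p, hep, hfp, rfl⟩ := H.exists_decomp z
  rw [H.form_decomp heq hfq hep hfp] at hz
  rw [← Ideal.radical_eq_top, Ideal.eq_top_iff_one, ← hz]
  exact add_mem (sub_mem (Ideal.mul_mem_right _ _ hb) (Ideal.mul_mem_right _ _ ha)) (hI p hep hfp)

/-- The complement `P` of the hyperbolic pair is nowhere degenerate. -/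
def FullForm (B : LinearMap.BilinForm R V) (e f : V) : Prop :=
  ∀ I : Ideal R, (∀ p p', B e p = 0 → B f p = 0 → B e p' = 0 → B f p' = 0 → B p p' ∈ I) → I = ⊤

/-- Nondegeneracy applied to the colon ideal (I : c). -/
lemma FullForm.mem (hP : FullForm B e f) {I : Ideal R} {c : R}
    (h : ∀ p p', B e p = 0 → B f p = 0 → B e p' = 0 → B f p' = 0 → c * B p p' ∈ I) : c ∈ I := by
  have := hP (Submodule.comap (LinearMap.mulLeft R c) I) h
  simpa using (Ideal.eq_top_iff_one _).1 this

lemma FullForm.symm (hP : FullForm B e f) : FullForm B f (-e) := by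
  intro I hI
  refine hP I fun p p' h1 h2 h3 h4 => hI p p' h2 (by simp [h1]) h4 (by simp [h3])

/-- The ideal of all `c` such that `T(v, 0, r c) ∈ E` for all `r`. -/
def longIdeal (hB : B.IsAlt) (E : Submonoid (Module.End R V)) (v : V) : Ideal R where
  carrier := {c | ∀ r, transvec B v 0 (r * c) ∈ E}
  zero_mem' r := by
    rw [mul_zero, transvec_zero]; exact E.one_mem
  add_mem' := by
    intro c c' hc hc' r
    have := transvec_mul hB (map_zero (B v)) (map_zero (B v)) (r * c) (r * c')
    rw [map_zero, add_zero, add_zero, ← mul_add] at this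
    rw [← this]
    exact E.mul_mem (hc r) (hc' r)
  smul_mem' := by
    intro s c hc r
    rw [smul_eq_mul, ← mul_assoc]
    exact hc _

lemma coord_mem_radical (H : ElemPair B e f E) (h2 : 2 * h = 1) (hP : FullForm B e f)
    (heq : B e q = 0) (hfq : B f q = 0) :
    b ∈ (longIdeal H.alt E (a • e + b • f + q)).radical := by
  -- The vectors b k(p) and b k(p') pair to b⁴⟨p, p'⟩; `FullForm.mem` strips off ⟨p, p'⟩.
  refine ⟨4, hP.mem fun p p' hep hfp hep' hfp' r => ?_⟩
  have h := mem_zero_of_mem_mem H.alt h2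
    (by rw [map_smul, H.perp_left heq hep hfp, smul_zero])
    (by rw [map_smul, H.perp_left heq hep' hfp', smul_zero])
    (H.mem_coord_left (a := a) (b := b) h2 heq hfq hep hfp)
    (H.mem_coord_left (a := a) (b := b) h2 heq hfq hep' hfp') r
  convert h using 2
  have hpe : B p e = 0 := by rw [← H.alt.neg_eq, hep, neg_zero]
  simp [hpe, hep', H.alt e]
  ring

lemma mem_zero (H : ElemPair B e f E) (h2 : 2 * h = 1) (hP : FullForm B e f)
    (heq : B e q = 0) (hfq : B f q = 0) {z : V} (hz : B (a • e + b • f + q) z = 1) (c : R) :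
    transvec B (a • e + b • f + q) 0 c ∈ E := by
  have : longIdeal H.alt E (a • e + b • f + q) = ⊤ := by
    refine H.ideal_eq_top heq hfq hz ?_ (H.coord_mem_radical h2 hP heq hfq) ?_
    · have := H.symm.coord_mem_radical (a := b) (b := -a) h2 hP.symm hfq (by simp [heq])
      rw [← symm_decomp] at this
      simpa using neg_mem this
    · intro p hep hfp
      -- With t = ⟨q, p⟩, the vectors t(bp - te) and t(-ap - tf) pair to -t⁴, hence the `-r` below.
      refine ⟨4, fun r => ?_⟩
      have h := mem_zero_of_mem_mem H.alt h2
        (by rw [map_smul, H.perp_left heq hep hfp, smul_zero])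
        (by rw [map_smul, H.perp_right hfq hep hfp, smul_zero])
        (H.mem_form_left (a := a) (b := b) h2 heq hfq hep hfp)
        (H.mem_form_right (a := a) (b := b) h2 heq hfq hep hfp) (-r)
      convert h using 2
      have hpf : B p f = 0 := by rw [← H.alt.neg_eq, hfp, neg_zero]
      simp [hpf, hep, H.alt p, H.pair']
      ring
  have h1 : c ∈ longIdeal H.alt E (a • e + b • f + q) := by rw [this]; trivial
  simpa using h1 1

/-- The submodule of all `w ∈ vᗮ` such that `T(v, r w, 0) ∈ E` for all `r`. -/
def shortSubmodule (hB : B.IsAlt) (E : Submonoid (Module.End R V)) (v : V)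
    (hv : ∀ c, transvec B v 0 c ∈ E) : Submodule R V where
  carrier := {w | B v w = 0 ∧ ∀ r : R, transvec B v (r • w) 0 ∈ E}
  zero_mem' := ⟨map_zero _, fun r => by rw [smul_zero]; exact hv 0⟩
  add_mem' := by
    rintro w w' ⟨hw, hm⟩ ⟨hw', hm'⟩
    refine ⟨by rw [map_add, hw, hw', add_zero], fun r => ?_⟩
    have e1 := transvec_mul hB (v := v) (w := r • w) (w' := r • w') (by simp [hw])
      (by simp [hw']) 0 0
    set s := 0 + 0 + B (r • w) (r • w')
    have e2 := transvec_mul hB (v := v) (w := r • w + r • w') (w' := 0) (by simp [hw, hw'])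
      (by simp) s (-s)
    rw [map_zero, add_zero, add_zero, add_neg_cancel, ← e1] at e2
    rw [smul_add, ← e2]
    exact E.mul_mem (E.mul_mem (hm r) (hm' r)) (hv _)
  smul_mem' := by
    rintro s w ⟨hw, hm⟩
    exact ⟨by simp [hw], fun r => by rw [smul_smul]; exact hm _⟩

variable (hv : ∀ c, transvec B (a • e + b • f + q) 0 c ∈ E)

lemma perp_mem_short (H : ElemPair B e f E) (h2 : 2 * h = 1) (heq : B e q = 0) (hfq : B f q = 0)
    {p : V} (hep : B e p = 0) (hfp : B f p = 0) (hqp : B q p = 0) :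
    p ∈ shortSubmodule H.alt E _ hv := by
  have hpq : B p q = 0 := by rw [← H.alt.neg_eq, hqp, neg_zero]
  refine ⟨by simp [hep, hfp, hqp], fun r => ?_⟩
  rw [transvec_comm]
  exact H.mem_of_perp_left h2 (by simp [hep]) (by simp [hfp]) heq hfq (by simp [hpq]) 0

lemma self_mem_short (H : ElemPair B e f E) :
    a • e + b • f + q ∈ shortSubmodule H.alt E _ hv := by
  refine ⟨H.alt _, fun r => ?_⟩
  have := transvec_add_smul_self (B := B) (a • e + b • f + q) 0 r 0
  rw [zero_add] at this
  rw [this]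
  exact hv _

lemma coord_smul_mem_short (H : ElemPair B e f E) (h2 : 2 * h = 1) (heq : B e q = 0)
    (hfq : B f q = 0) {p : V} (hep : B e p = 0) (hfp : B f p = 0) :
    b • (b • p + (-B q p) • e) ∈ shortSubmodule H.alt E _ hv :=
  ⟨by rw [map_smul, H.perp_left heq hep hfp, smul_zero], H.mem_coord_left h2 heq hfq hep hfp⟩

lemma coord_smul_mem_short' (H : ElemPair B e f E) (h2 : 2 * h = 1) (heq : B e q = 0)
    (hfq : B f q = 0) {p : V} (hep : B e p = 0) (hfp : B f p = 0) :
    (-a) • ((-a) • p + (-B q p) • f) ∈ shortSubmodule H.alt E _ hv :=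
  ⟨by rw [map_smul, H.perp_right hfq hep hfp, smul_zero],
    H.mem_coord_right h2 heq hfq hep hfp⟩

/-- Polarizing ⟨q, x⟩k(x) gives ⟨q, p'⟩k(p) + ⟨q, p⟩k(p'). In the corresponding difference the
multiples of e cancel, leaving b times a vector of P orthogonal to q. Adding and halving isolates
one term. -/
lemma form_smul_mem_short (H : ElemPair B e f E) (h2 : 2 * h = 1) (heq : B e q = 0)
    (hfq : B f q = 0) {p p' : V} (hep : B e p = 0) (hfp : B f p = 0) (hep' : B e p' = 0)
    (hfp' : B f p' = 0) :
    B q p' • (b • p + (-B q p) • e) ∈ shortSubmodule H.alt E _ hv := by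
  have key : ∀ x, B e x = 0 → B f x = 0 →
      B q x • (b • x + (-B q x) • e) ∈ shortSubmodule H.alt E _ hv := fun x hx hx' =>
    ⟨by rw [map_smul, H.perp_left heq hx hx', smul_zero], H.mem_form_left h2 heq hfq hx hx'⟩
  have m1 := key p hep hfp
  have m2 := key p' hep' hfp'
  have m3 := key (p + p') (by simp [hep, hep']) (by simp [hfp, hfp'])
  have m4 := H.perp_mem_short hv h2 heq hfq (p := B q p' • p - B q p • p') (by simp [hep, hep'])
    (by simp [hfp, hfp']) (by simp; ring)
  have := Submodule.smul_mem _ h (add_mem (sub_mem (sub_mem m3 m1) m2) (Submodule.smul_mem _ b m4))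
  convert this using 1
  rw [map_add]
  trans (2 * h) • (B q p' • (b • p + (-B q p) • e))
  · rw [h2, one_smul]
  · module

lemma koszul_left_mem_short (H : ElemPair B e f E) (h2 : 2 * h = 1) (heq : B e q = 0)
    (hfq : B f q = 0) {z : V} (hz : B (a • e + b • f + q) z = 1) {p : V} (hep : B e p = 0)
    (hfp : B f p = 0) : b • p + (-B q p) • e ∈ shortSubmodule H.alt E _ hv := by
  set W := shortSubmodule H.alt E _ hv
  have : W.comap (LinearMap.toSpanSingleton R V (b • p + (-B q p) • e)) = ⊤ := by
    refine H.ideal_eq_top heq hfq hz ⟨2, ?_⟩ (Ideal.le_radical ?_)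
      fun p' hep' hfp' => Ideal.le_radical ?_
    · rw [Submodule.mem_comap, LinearMap.toSpanSingleton_apply]
      -- With t = ⟨q, p⟩: a²k(p) = b(a²p + atf) - at(ae + bf), where ae + bf = v - q.
      have m1 := H.coord_smul_mem_short' hv h2 heq hfq hep hfp
      have m2 := sub_mem (H.self_mem_short hv)
        (H.perp_mem_short hv h2 heq hfq heq hfq (H.alt q))
      have := sub_mem (Submodule.smul_mem _ b m1) (Submodule.smul_mem _ (a * B q p) m2)
      convert this using 1
      module
    · exact H.coord_smul_mem_short hv h2 heq hfq hep hfp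
    · exact H.form_smul_mem_short hv h2 heq hfq hep hfp hep' hfp'
  have h1 : (1 : R) ∈ W.comap (LinearMap.toSpanSingleton R V (b • p + (-B q p) • e)) := by
    rw [this]; trivial
  simpa using h1

lemma koszul_right_mem_short (H : ElemPair B e f E) (h2 : 2 * h = 1) (heq : B e q = 0)
    (hfq : B f q = 0) {z : V} (hz : B (a • e + b • f + q) z = 1) {p : V} (hep : B e p = 0)
    (hfp : B f p = 0) : (-a) • p + (-B q p) • f ∈ shortSubmodule H.alt E _ hv := by
  have hv' := hv
  rw [symm_decomp] at hz hv'
  have := H.symm.koszul_left_mem_short hv' h2 hfq (by simp [heq]) hz hfp (by simp [hep])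
  convert this using 2
  exact symm_decomp _ _ _ _ _

end Fixed

/-- All transvections along unimodular vectors are elementary. -/
theorem transvec_mem (H : ElemPair B e f E) {h : R} (h2 : 2 * h = 1) (hP : FullForm B e f)
    {v z w : V} (hz : B v z = 1) (hw : B v w = 0) (c : R) : transvec B v w c ∈ E := by
  obtain ⟨a, b, q, heq, hfq, rfl⟩ := H.exists_decomp v
  have hv := H.mem_zero h2 hP heq hfq hz
  suffices hW : w ∈ shortSubmodule H.alt E _ hv by
    have h1 := transvec_mul H.alt hW.1 (map_zero _) 0 c
    rw [map_zero, add_zero, add_zero, zero_add] at h1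
    rw [← h1]
    refine E.mul_mem ?_ (hv c)
    simpa using hW.2 1
  obtain ⟨a₁, b₁, p₁, he₁, hf₁, hz'⟩ := H.exists_decomp z
  obtain ⟨a₂, b₂, p₂, he₂, hf₂, hw'⟩ := H.exists_decomp w
  have hzd := hz
  have hwd := hw
  rw [hz', H.form_decomp heq hfq he₁ hf₁] at hzd
  rw [hw', H.form_decomp heq hfq he₂ hf₂] at hwd
  have l₁ := H.koszul_left_mem_short hv h2 heq hfq hz he₁ hf₁
  have l₂ := H.koszul_left_mem_short hv h2 heq hfq hz he₂ hf₂
  have r₁ := H.koszul_right_mem_short hv h2 heq hfq hz he₁ hf₁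
  have r₂ := H.koszul_right_mem_short hv h2 heq hfq hz he₂ hf₂
  have m1 := sub_mem (H.self_mem_short hv) (H.perp_mem_short hv h2 heq hfq heq hfq (H.alt q))
  have m2 := H.perp_mem_short hv h2 heq hfq (p := B q p₁ • p₂ - B q p₂ • p₁) (by simp [he₁, he₂])
    (by simp [hf₁, hf₂]) (by simp; ring)
  have key := add_mem (add_mem (sub_mem (Submodule.smul_mem _ a₁ l₂) (Submodule.smul_mem _ a₂ l₁))
    (sub_mem (Submodule.smul_mem _ b₁ r₂) (Submodule.smul_mem _ b₂ r₁)))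
    (add_mem (Submodule.smul_mem _ (a₁ * b₂ - a₂ * b₁) m1) m2)
  -- The coefficients become ⟨v, z⟩ and ⟨v, w⟩: exactness of the Koszul complex of a unimodular
  -- vector.
  have : w = (1 : R) • w - (0 : R) • z := by module
  rw [this, ← hzd, ← hwd, hw', hz']
  convert key using 1
  module

end ElemPair

end Transvection

end AltForm

namespace AltForm

/-! ### Pfaffian 1 implies invertible -/

section Pfaffian

variable {R V : Type*} [CommRing R] [AddCommGroup V] [Module R V]

-- This signed sum becomes the first-row expansion of the Pfaffian.
open CliffordAlgebra in
lemma contractLeft_ιMulti (d : Module.Dual R V) (m : ℕ) (v : Fin (m + 1) → V) :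
    contractLeft (Q := (0 : QuadraticForm R V)) d (ExteriorAlgebra.ιMulti R (m + 1) v) =
      ∑ j : Fin (m + 1), ((-1) ^ (j : ℕ) * d (v j)) •
        ExteriorAlgebra.ιMulti R m (fun i => v (j.succAbove i)) := by
  induction m with
  | zero =>
    rw [ExteriorAlgebra.ιMulti_succ_apply]
    simp only [ExteriorAlgebra.ιMulti_zero_apply]
    erw [mul_one, contractLeft_ι]
    simp [Algebra.algebraMap_eq_smul_one]
  | succ m ih =>
    rw [ExteriorAlgebra.ιMulti_succ_apply]
    erw [contractLeft_ι_mul]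
    rw [Fin.sum_univ_succ]
    erw [ih]
    rw [Finset.mul_sum, sub_eq_add_neg, ← Finset.sum_neg_distrib]
    congr 1
    · simp [vecTail, Function.comp_def]
    · refine Finset.sum_congr rfl fun j _ => ?_
      rw [ExteriorAlgebra.ιMulti_succ_apply]
      erw [mul_smul_comm]
      simp [pow_succ, vecTail, Function.comp_def]

variable {B : LinearMap.BilinForm R V}

/-- As B is alternating, `changeForm` along -B maps the exterior algebra to itself; the sign makes
the contraction terms positive. -/
lemma toQuadraticMap_neg_of_isAlt (hB : B.IsAlt) :
    (-B).toQuadraticMap = (0 : QuadraticForm R V) - 0 := by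
  ext x; simp [hB x]

/-- The Pfaffian of a Gram matrix, as an alternating map of the vectors. -/
noncomputable def pfAlt (hB : B.IsAlt) (m : ℕ) : V [⋀^Fin m]→ₗ[R] R :=
  ((ExteriorAlgebra.algebraMapInv (R := R) (M := V)).toLinearMap ∘ₗ
    CliffordAlgebra.changeForm (toQuadraticMap_neg_of_isAlt hB)).compAlternatingMap
      (ExteriorAlgebra.ιMulti R m)

/-- The scalar part kills multiples of ι(v₀), so only the contraction term survives. -/
lemma pfAlt_succ_succ (hB : B.IsAlt) (m : ℕ) (v : Fin (m + 2) → V) :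
    pfAlt hB (m + 2) v = ∑ j : Fin (m + 1), (-1) ^ (j : ℕ) * B (v 0) (v j.succ) *
      pfAlt hB m (fun i => v (j.succAbove i).succ) := by
  simp only [pfAlt, LinearMap.compAlternatingMap_apply, LinearMap.comp_apply]
  rw [ExteriorAlgebra.ιMulti_succ_apply]
  erw [CliffordAlgebra.changeForm_ι_mul]
  rw [map_sub]
  have h1 : ∀ x : ExteriorAlgebra R V, (ExteriorAlgebra.algebraMapInv (R := R) (M := V)).toLinearMap
      (ExteriorAlgebra.ι R (v 0) * x) = 0 := by
    intro x
    simp [ExteriorAlgebra.algebraMapInv]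
  erw [h1, ← CliffordAlgebra.changeForm_contractLeft, contractLeft_ιMulti]
  simp only [map_sum, map_smul, zero_sub, vecTail, Function.comp_def]
  rw [← Finset.sum_neg_distrib]
  refine Finset.sum_congr rfl fun j _ => ?_
  simp

/-- Shows that the recursive Pfaffian is alternating in the vectors, which the expansion hides. -/
lemma pfaffian_gram (hB : B.IsAlt) (m : ℕ) (v : Fin m → V) :
    pfaffian m (Matrix.of fun i j => B (v i) (v j)) = pfAlt hB m v := by
  induction m using Nat.twoStepInduction with
  | zero =>
    simp only [pfaffian, pfAlt, LinearMap.compAlternatingMap_apply, LinearMap.comp_apply,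
      ExteriorAlgebra.ιMulti_zero_apply]
    erw [CliffordAlgebra.changeForm_one]
    simp
  | one =>
    simp only [pfaffian, pfAlt, LinearMap.compAlternatingMap_apply, LinearMap.comp_apply,
      ExteriorAlgebra.ιMulti_succ_apply, ExteriorAlgebra.ιMulti_zero_apply]
    erw [mul_one, CliffordAlgebra.changeForm_ι]
    simp [ExteriorAlgebra.algebraMapInv]
  | more m ih _ =>
    rw [pfAlt_succ_succ, pfaffian]
    refine Finset.sum_congr rfl fun j _ => ?_
    rw [← ih]
    rfl

lemma pfaffian_submatrix {ι : Type*} [Fintype ι] [DecidableEq ι] {A : Matrix ι ι R}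
    (hA : (Matrix.toBilin' A).IsAlt) (m : ℕ) (f : Fin m → ι) :
    pfaffian m (A.submatrix f f) = pfAlt hA m (fun i => Pi.single (f i) 1) := by
  rw [← pfaffian_gram]
  congr 1
  ext i j
  simp [Matrix.toBilin'_apply', Matrix.col]

lemma isAlt_toBilin' (h2 : IsUnit (2 : R)) {m : ℕ} {A : Matrix (Fin m) (Fin m) R} (hA : Aᵀ = -A) :
    (Matrix.toBilin' A).IsAlt := fun x => by
  rw [Matrix.toBilin'_apply']
  exact skew_dotProduct_self h2 hA x

/-- Take p to be the signed sub-Pfaffians: coordinate i of Ap is the Pfaffian with index 0 replaced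
by i, which vanishes for i ≠ 0 because i is then repeated. -/
lemma mulVec_pfaffian_minors {m : ℕ} {A : Matrix (Fin (m + 2)) (Fin (m + 2)) R}
    (hA : (Matrix.toBilin' A).IsAlt) :
    ∃ p, A *ᵥ p = Pi.single 0 (pfaffian (m + 2) A) := by
  refine ⟨Fin.cons 0 fun j => (-1) ^ (j : ℕ) *
    pfaffian m (A.submatrix (fun i => (j.succAbove i).succ) (fun i => (j.succAbove i).succ)), ?_⟩
  ext i
  have h1 : (A *ᵥ (Fin.cons 0 fun j : Fin (m + 1) => (-1) ^ (j : ℕ) *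
      pfaffian m (A.submatrix (fun i => (j.succAbove i).succ) (fun i => (j.succAbove i).succ)))) i =
      pfaffian (m + 2) (A.submatrix (Fin.cons i Fin.succ : Fin (m + 2) → Fin (m + 2))
        (Fin.cons i Fin.succ : Fin (m + 2) → Fin (m + 2))) := by
    rw [pfaffian, mulVec, dotProduct, Fin.sum_univ_succ]
    simp only [Fin.cons_zero, mul_zero, zero_add, Fin.cons_succ, Matrix.submatrix_apply,
      Matrix.submatrix_submatrix, Function.comp_def]
    exact Finset.sum_congr rfl fun j _ => by ring
  rw [h1]
  refine Fin.cases ?_ (fun i => ?_) i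
  · rw [Pi.single_eq_same]
    congr 1
    have : (Fin.cons 0 Fin.succ : Fin (m + 2) → Fin (m + 2)) = id := by
      ext j; refine Fin.cases ?_ (fun j => ?_) j <;> simp
    rw [this, Matrix.submatrix_id_id]
  · rw [Pi.single_eq_of_ne (Fin.succ_ne_zero i), pfaffian_submatrix hA]
    exact (pfAlt hA (m + 2)).map_eq_zero_of_eq _ (i := 0) (j := i.succ) (by simp)
      (Fin.succ_ne_zero i).symm

/-- Swapping indices 0 and i changes the Pfaffian only by a sign, so every basis vector is in the
image of A, and A has a right inverse. -/
lemma isUnit_det_of_pfaffian (h2 : IsUnit (2 : R)) {m : ℕ}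
    {A : Matrix (Fin (m + 2)) (Fin (m + 2)) R} (hA : Aᵀ = -A) (hpf : pfaffian (m + 2) A = 1) :
    IsUnit A.det := by
  have hB := isAlt_toBilin' h2 hA
  have key : ∀ i, ∃ p, A *ᵥ p = Pi.single i 1 := by
    intro i
    have hσ : (A.submatrix (Equiv.swap 0 i) (Equiv.swap 0 i))ᵀ =
        -(A.submatrix (Equiv.swap 0 i) (Equiv.swap 0 i)) := by
      rw [Matrix.transpose_submatrix, hA]; rfl
    obtain ⟨p, hp⟩ := mulVec_pfaffian_minors (isAlt_toBilin' h2 hσ)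
    rw [pfaffian_submatrix hB] at hp
    have h1 := (pfAlt hB (m + 2)).map_perm (fun j => Pi.single j 1) (Equiv.swap 0 i)
    have h3 := pfaffian_submatrix hB (m + 2) id
    rw [Matrix.submatrix_id_id, hpf] at h3
    simp only [id] at h3
    rw [← h3] at h1
    simp only [Function.comp_def] at h1
    rw [h1] at hp
    refine ⟨(Equiv.Perm.sign (Equiv.swap 0 i)) • (p ∘ (Equiv.swap 0 i)), ?_⟩
    ext j
    have := congrFun hp (Equiv.swap 0 i j)
    rw [Matrix.submatrix_mulVec_equiv] at this
    simp only [Function.comp_apply, Equiv.swap_apply_self, Equiv.symm_swap] at this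
    rw [Matrix.mulVec_smul, Pi.smul_apply, this]
    by_cases hj : j = i
    · subst hj
      rw [Equiv.swap_apply_right, Pi.single_eq_same, Pi.single_eq_same, smul_smul,
        Int.units_mul_self, one_smul]
    · rw [Pi.single_eq_of_ne hj, Pi.single_eq_of_ne, smul_zero]
      intro h0
      exact hj (by rw [← Equiv.swap_apply_self 0 i j, h0, Equiv.swap_apply_left])
  choose p hp using key
  rw [← Matrix.isUnit_iff_isUnit_det]
  refine IsUnit.of_mul_eq_one (Matrix.of fun i j => p j i) ?_
  ext i j
  have := congrFun (hp j) i
  rw [Matrix.one_apply, ← Pi.single_apply, ← this]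
  rfl

end Pfaffian

end AltForm

namespace AltForm

/-! ### From matrices to transvections -/

section Transfer

variable {R : Type*} [CommRing R] {k : ℕ}

lemma border_mulVec_cons (a : R) (u w : Fin k → R) (M : Matrix (Fin k) (Fin k) R) (t : R)
    (y : Fin k → R) :
    border a u w M *ᵥ (Fin.cons t y : Fin (k + 1) → R) =
      Fin.cons (a * t + u ⬝ᵥ y) (t • w + M *ᵥ y) := by
  ext i
  refine Fin.cases ?_ (fun i => ?_) i <;>
    simp [border, mulVec, dotProduct, Fin.sum_univ_succ, mul_comm]

lemma cons_dotProduct_cons (s t : R) (x y : Fin k → R) :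
    (Fin.cons s x : Fin (k + 1) → R) ⬝ᵥ (Fin.cons t y : Fin (k + 1) → R) = s * t + x ⬝ᵥ y := by
  simp [dotProduct, Fin.sum_univ_succ]

lemma eq_border (h2 : IsUnit (2 : R)) {φ : Matrix (Fin (k + 1)) (Fin (k + 1)) R}
    (hφ : φᵀ = -φ) : φ = border 0 (-cVec φ) (cVec φ) (nuMat φ) := by
  ext i j
  refine Fin.cases ?_ (fun i => ?_) i <;> refine Fin.cases ?_ (fun j => ?_) j <;>
    simp [border, cVec, nuMat, skew_diag h2 hφ]
  simpa using congrFun (congrFun hφ j.succ) 0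

lemma inv_eq_border (h2 : IsUnit (2 : R)) {φ : Matrix (Fin (k + 1)) (Fin (k + 1)) R}
    (hφ : φᵀ = -φ) (hdet : IsUnit φ.det) :
    φ⁻¹ = border 0 (dVec φ) (-dVec φ) (muMat φ) := by
  have hi := skew_inv hφ hdet
  ext i j
  refine Fin.cases ?_ (fun i => ?_) i <;> refine Fin.cases ?_ (fun j => ?_) j <;>
    simp [border, dVec, muMat, skew_diag h2 hi]
  simpa using congrFun (congrFun hi 0) i.succ

lemma toBilin'_cons (h2 : IsUnit (2 : R)) {φ : Matrix (Fin (k + 1)) (Fin (k + 1)) R}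
    (hφ : φᵀ = -φ) (s t : R) (x y : Fin k → R) :
    Matrix.toBilin' φ (Fin.cons s x) (Fin.cons t y) =
      t * (cVec φ ⬝ᵥ x) - s * (cVec φ ⬝ᵥ y) + x ⬝ᵥ (nuMat φ *ᵥ y) := by
  conv_lhs => rw [eq_border h2 hφ]
  rw [Matrix.toBilin'_apply', border_mulVec_cons, cons_dotProduct_cons, dotProduct_add,
    dotProduct_smul, dotProduct_comm x]
  simp
  ring

/-- Read blockwise, φ⁻¹φ = 1 gives d·c = 1, μc = 0 and dcᵗ + μν = 1. -/
lemma inv_mul_eq_one_border (h2 : IsUnit (2 : R)) {φ : Matrix (Fin (k + 1)) (Fin (k + 1)) R}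
    (hφ : φᵀ = -φ) (hdet : IsUnit φ.det) :
    border (dVec φ ⬝ᵥ cVec φ) (dVec φ ᵥ* nuMat φ) (muMat φ *ᵥ cVec φ)
      (vecMulVec (dVec φ) (cVec φ) + muMat φ * nuMat φ) = border 1 0 0 1 := by
  have h := Matrix.nonsing_inv_mul φ hdet
  rw [inv_eq_border h2 hφ hdet] at h
  nth_rewrite 4 [eq_border h2 hφ] at h
  rw [border_mul, ← border_one] at h
  rw [← h]
  simp [Matrix.neg_vecMulVec, Matrix.vecMulVec_neg]

lemma dVec_dotProduct_cVec (h2 : IsUnit (2 : R)) {φ : Matrix (Fin (k + 1)) (Fin (k + 1)) R}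
    (hφ : φᵀ = -φ) (hdet : IsUnit φ.det) : dVec φ ⬝ᵥ cVec φ = 1 := by
  simpa [border] using congrFun (congrFun (inv_mul_eq_one_border h2 hφ hdet) 0) 0

lemma muMat_mulVec_nuMat (h2 : IsUnit (2 : R)) {φ : Matrix (Fin (k + 1)) (Fin (k + 1)) R}
    (hφ : φᵀ = -φ) (hdet : IsUnit φ.det) (y : Fin k → R) :
    muMat φ *ᵥ (nuMat φ *ᵥ y) = y - (cVec φ ⬝ᵥ y) • dVec φ := by
  have h : vecMulVec (dVec φ) (cVec φ) + muMat φ * nuMat φ = 1 := by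
    ext i j
    simpa [border] using congrFun (congrFun (inv_mul_eq_one_border h2 hφ hdet) i.succ) j.succ
  rw [Matrix.mulVec_mulVec, eq_sub_iff_add_eq'.2 h, Matrix.sub_mulVec, Matrix.one_mulVec,
    Matrix.vecMulVec_mulVec]
  simp

lemma muMat_mulVec_cVec (h2 : IsUnit (2 : R)) {φ : Matrix (Fin (k + 1)) (Fin (k + 1)) R}
    (hφ : φᵀ = -φ) (hdet : IsUnit φ.det) : muMat φ *ᵥ cVec φ = 0 := by
  ext i
  simpa [border] using congrFun (congrFun (inv_mul_eq_one_border h2 hφ hdet) i.succ) 0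

/-- The standard vector `e₀`, the first half of the hyperbolic pair attached to `φ`. -/
def pairE (k : ℕ) (R : Type*) [CommRing R] : Fin (k + 1) → R := Fin.cons 1 0

/-- The vector `(0, d)`, the second half of the hyperbolic pair attached to `φ`. -/
noncomputable def pairF (φ : Matrix (Fin (k + 1)) (Fin (k + 1)) R) : Fin (k + 1) → R :=
  Fin.cons 0 (dVec φ)

lemma toBilin'_pairE (h2 : IsUnit (2 : R)) {φ : Matrix (Fin (k + 1)) (Fin (k + 1)) R}
    (hφ : φᵀ = -φ) (t : R) (y : Fin k → R) :
    Matrix.toBilin' φ (pairE k R) (Fin.cons t y) = -(cVec φ ⬝ᵥ y) := by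
  rw [pairE, toBilin'_cons h2 hφ]; simp

lemma dVec_dotProduct_nuMat (h2 : IsUnit (2 : R)) {φ : Matrix (Fin (k + 1)) (Fin (k + 1)) R}
    (hφ : φᵀ = -φ) (hdet : IsUnit φ.det) (y : Fin k → R) : dVec φ ⬝ᵥ (nuMat φ *ᵥ y) = 0 := by
  have hν : (nuMat φ)ᵀ = -nuMat φ := skew_submatrix hφ
  rw [Matrix.dotProduct_mulVec, ← Matrix.mulVec_transpose, hν, Matrix.neg_mulVec,
    nuMat_mulVec_dVec h2 hφ hdet]
  simp

lemma toBilin'_pairF (h2 : IsUnit (2 : R)) {φ : Matrix (Fin (k + 1)) (Fin (k + 1)) R}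
    (hφ : φᵀ = -φ) (hdet : IsUnit φ.det) (t : R) (y : Fin k → R) :
    Matrix.toBilin' φ (pairF φ) (Fin.cons t y) = t := by
  rw [pairF, toBilin'_cons h2 hφ, dVec_dotProduct_nuMat h2 hφ hdet, dotProduct_comm,
    dVec_dotProduct_cVec h2 hφ hdet]
  simp

lemma toLin'_CMat (h2 : IsUnit (2 : R)) {φ : Matrix (Fin (k + 1)) (Fin (k + 1)) R}
    (hφ : φᵀ = -φ) (hdet : IsUnit φ.det) (v : Fin k → R) :
    Matrix.toLin' (CMat φ v) =
      transvec (Matrix.toBilin' φ) (pairF φ) (Fin.cons 0 v) (-(cVec φ ⬝ᵥ v)) := by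
  refine LinearMap.ext fun x => ?_
  obtain ⟨t, y, rfl⟩ : ∃ t y, x = Fin.cons t y := ⟨_, _, (Fin.cons_self_tail x).symm⟩
  rw [transvec_apply, toBilin'_pairF h2 hφ hdet, toBilin'_cons h2 hφ, Matrix.toLin'_apply, CMat,
    border_mulVec_cons, alphaMat, Matrix.add_mulVec, Matrix.one_mulVec, ← Matrix.mulVec_mulVec,
    Matrix.vecMulVec_mulVec, pairF]
  ext i
  refine Fin.cases ?_ (fun i => ?_) i
  · simp
  · simp
    ring

lemma toLin'_RMat (h2 : IsUnit (2 : R)) {φ : Matrix (Fin (k + 1)) (Fin (k + 1)) R}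
    (hφ : φᵀ = -φ) (hdet : IsUnit φ.det) (v : Fin k → R) :
    Matrix.toLin' (RMat φ v) =
      transvec (Matrix.toBilin' φ) (pairE k R) (Fin.cons 0 (-(muMat φ *ᵥ v)))
        (-(dVec φ ⬝ᵥ v)) := by
  have hμ : (muMat φ)ᵀ = -muMat φ := skew_submatrix (skew_inv hφ hdet)
  have hdot : ∀ z, (-(muMat φ *ᵥ v)) ⬝ᵥ z = v ⬝ᵥ (muMat φ *ᵥ z) := fun z => by
    rw [← Matrix.neg_mulVec, ← hμ, Matrix.mulVec_transpose, Matrix.dotProduct_mulVec]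
  refine LinearMap.ext fun x => ?_
  obtain ⟨t, y, rfl⟩ : ∃ t y, x = Fin.cons t y := ⟨_, _, (Fin.cons_self_tail x).symm⟩
  rw [transvec_apply, toBilin'_pairE h2 hφ, toBilin'_cons h2 hφ, Matrix.toLin'_apply, RMat,
    border_mulVec_cons, betaMat, Matrix.add_mulVec, Matrix.one_mulVec, ← Matrix.mulVec_mulVec,
    Matrix.vecMulVec_mulVec, pairE, dotProduct_comm (cVec φ) (-_), hdot, hdot,
    muMat_mulVec_nuMat h2 hφ hdet, muMat_mulVec_cVec h2 hφ hdet, dotProduct_sub, dotProduct_smul,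
    dotProduct_comm v (dVec φ), Matrix.mulVec_smul]
  ext i
  refine Fin.cases ?_ (fun i => ?_) i
  · simp
    ring
  · simp

lemma exists_CMat (h2 : IsUnit (2 : R)) {φ : Matrix (Fin (k + 1)) (Fin (k + 1)) R}
    (hφ : φᵀ = -φ) (hdet : IsUnit φ.det) {w : Fin (k + 1) → R} (a : R)
    (hw : Matrix.toBilin' φ (pairF φ) w = 0) :
    ∃ v, Matrix.toLin' (CMat φ v) = transvec (Matrix.toBilin' φ) (pairF φ) w a := by
  obtain ⟨t, y, rfl⟩ : ∃ t y, w = Fin.cons t y := ⟨_, _, (Fin.cons_self_tail w).symm⟩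
  rw [toBilin'_pairF h2 hφ hdet] at hw
  subst hw
  -- Adding sd to y adds sf to w, which changes the scalar by 2s, while -c·v drops by s; so s = a +
  -- c·y is forced.
  refine ⟨y + (a + cVec φ ⬝ᵥ y) • dVec φ, ?_⟩
  have : (Fin.cons 0 (y + (a + cVec φ ⬝ᵥ y) • dVec φ) : Fin (k + 1) → R) =
      Fin.cons 0 y + (a + cVec φ ⬝ᵥ y) • pairF φ := by
    ext i
    refine Fin.cases ?_ (fun i => ?_) i <;> simp [pairF]
  rw [toLin'_CMat h2 hφ hdet, this, transvec_add_smul_self, dotProduct_add, dotProduct_smul,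
    dotProduct_comm _ (dVec φ), dVec_dotProduct_cVec h2 hφ hdet]
  congr 1
  simp
  ring

lemma exists_RMat (h2 : IsUnit (2 : R)) {φ : Matrix (Fin (k + 1)) (Fin (k + 1)) R}
    (hφ : φᵀ = -φ) (hdet : IsUnit φ.det) {w : Fin (k + 1) → R} (a : R)
    (hw : Matrix.toBilin' φ (pairE k R) w = 0) :
    ∃ v, Matrix.toLin' (RMat φ v) = transvec (Matrix.toBilin' φ) (pairE k R) w a := by
  obtain ⟨t, y, rfl⟩ : ∃ t y, w = Fin.cons t y := ⟨_, _, (Fin.cons_self_tail w).symm⟩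
  rw [toBilin'_pairE h2 hφ, neg_eq_zero] at hw
  -- Since c·y = 0, -μ maps -νy to y; the multiple of c is killed by μ and sets the scalar to a +
  -- 2t, the 2t accounting for the component te of w.
  refine ⟨-(nuMat φ *ᵥ y) - (a + 2 * t) • cVec φ, ?_⟩
  have e1 : (Fin.cons t y : Fin (k + 1) → R) = Fin.cons 0 y + t • pairE k R := by
    ext i
    refine Fin.cases ?_ (fun i => ?_) i <;> simp [pairE]
  rw [toLin'_RMat h2 hφ hdet, e1, transvec_add_smul_self, Matrix.mulVec_sub, Matrix.mulVec_neg,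
    muMat_mulVec_nuMat h2 hφ hdet, Matrix.mulVec_smul, muMat_mulVec_cVec h2 hφ hdet, hw,
    dotProduct_sub, dotProduct_neg, dVec_dotProduct_nuMat h2 hφ hdet, dotProduct_smul,
    dVec_dotProduct_cVec h2 hφ hdet]
  simp

/-- The endomorphisms of `R^{k+1}` given by the elements of `ESp φ`. -/
noncomputable def ESpEnd (φ : Matrix (Fin (k + 1)) (Fin (k + 1)) R) :
    Submonoid (Module.End R (Fin (k + 1) → R)) :=
  ((ESp φ).toSubmonoid.map (Units.coeHom _)).map
    (Matrix.toLinAlgEquiv' : Matrix (Fin (k + 1)) (Fin (k + 1)) R ≃ₐ[R] _)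

lemma mem_ESpEnd {φ : Matrix (Fin (k + 1)) (Fin (k + 1)) R} {L} :
    L ∈ ESpEnd φ ↔ ∃ g ∈ ESp φ, Matrix.toLin' (g : Matrix (Fin (k + 1)) (Fin (k + 1)) R) = L := by
  simp [ESpEnd, Submonoid.mem_map]
  rfl

lemma toLin'_mem_ESpEnd {φ : Matrix (Fin (k + 1)) (Fin (k + 1)) R}
    {g : GL (Fin (k + 1)) R} :
    Matrix.toLin' (g : Matrix (Fin (k + 1)) (Fin (k + 1)) R) ∈ ESpEnd φ ↔ g ∈ ESp φ := by
  rw [mem_ESpEnd]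
  refine ⟨?_, fun h => ⟨g, h, rfl⟩⟩
  rintro ⟨g', hg', h⟩
  rwa [← Units.ext (Matrix.toLin'.injective h)]

lemma elemPair (h2 : IsUnit (2 : R)) {φ : Matrix (Fin (k + 1)) (Fin (k + 1)) R}
    (hφ : φᵀ = -φ) (hdet : IsUnit φ.det) :
    ElemPair (Matrix.toBilin' φ) (pairE k R) (pairF φ) (ESpEnd φ) where
  alt := isAlt_toBilin' h2 hφ
  pair := toBilin'_pairF h2 hφ hdet 1 0
  mem_left w a hw := by
    obtain ⟨v, hv⟩ := exists_RMat h2 hφ hdet a hw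
    exact mem_ESpEnd.2 ⟨(isUnit_RMat h2 hφ hdet v).unit, Subgroup.subset_closure (Or.inr ⟨v, rfl⟩),
      hv⟩
  mem_right w a hw := by
    obtain ⟨v, hv⟩ := exists_CMat h2 hφ hdet a hw
    exact mem_ESpEnd.2 ⟨(isUnit_CMat h2 hφ hdet v).unit, Subgroup.subset_closure (Or.inl ⟨v, rfl⟩),
      hv⟩

/-- If a proper ideal I contained ⟨P, P⟩, invertibility of φ would put P inside I·R^{k+1}, and e, f
would span (R/I)^{k+1}, contradicting k + 1 > 2. -/
lemma fullForm (h2 : IsUnit (2 : R)) {φ : Matrix (Fin (k + 1)) (Fin (k + 1)) R}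
    (hφ : φᵀ = -φ) (hdet : IsUnit φ.det) (hk : 2 < k + 1) :
    ElemPair.FullForm (Matrix.toBilin' φ) (pairE k R) (pairF φ) := by
  intro I hI
  by_contra hne
  have H := elemPair h2 hφ hdet
  have hp : ∀ p, Matrix.toBilin' φ (pairE k R) p = 0 → Matrix.toBilin' φ (pairF φ) p = 0 →
      ∀ i, p i ∈ I := by
    intro p hep hfp i
    have h1 : ∀ j, (φ *ᵥ p) j ∈ I := by
      intro j
      obtain ⟨a, b, q, heq, hfq, hq⟩ := H.exists_decomp (Pi.single j 1)
      have h3 := H.form_decomp (a := a) (b := b) (a' := 0) (b' := 0) heq hfq hep hfp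
      rw [zero_smul, zero_smul, zero_add, zero_add, ← hq, Matrix.toBilin'_apply',
        single_one_dotProduct] at h3
      rw [h3]
      simpa using hI q p heq hfq hep hfp
    have h4 : p i = (φ⁻¹ *ᵥ (φ *ᵥ p)) i := by
      rw [Matrix.mulVec_mulVec, Matrix.nonsing_inv_mul _ hdet, Matrix.one_mulVec]
    rw [h4, mulVec, dotProduct]
    exact Ideal.sum_mem _ fun j _ => Ideal.mul_mem_left _ _ (h1 j)
  have : Nontrivial (R ⧸ I) := Ideal.Quotient.nontrivial_iff.2 hne
  let F : (Fin 2 → R ⧸ I) →ₗ[R ⧸ I] (Fin (k + 1) → R ⧸ I) :=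
    (LinearMap.proj 0).smulRight (fun i => Ideal.Quotient.mk I (pairE k R i)) +
      (LinearMap.proj 1).smulRight (fun i => Ideal.Quotient.mk I (pairF φ i))
  have hF : Function.Surjective F := by
    intro y
    choose z hz using fun i => Ideal.Quotient.mk_surjective (y i)
    obtain ⟨a, b, q, heq, hfq, hq⟩ := H.exists_decomp z
    refine ⟨![Ideal.Quotient.mk I a, Ideal.Quotient.mk I b], ?_⟩
    ext i
    have h0 := Ideal.Quotient.eq_zero_iff_mem.2 (hp q heq hfq i)
    rw [← hz i, congrFun hq i]
    simp [F, h0]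
  have := le_of_fin_surjective (R ⧸ I) F hF
  omega

lemma mem_Sp_iff {m : ℕ} {φ : Matrix (Fin m) (Fin m) R} {g : GL (Fin m) R} :
    g ∈ Sp φ ↔ ∀ x y, Matrix.toBilin' φ (Matrix.toLin' (g : Matrix (Fin m) (Fin m) R) x)
      (Matrix.toLin' (g : Matrix (Fin m) (Fin m) R) y) = Matrix.toBilin' φ x y := by
  have h : g ∈ Sp φ ↔ (g : Matrix (Fin m) (Fin m) R)ᵀ * φ * (g : Matrix (Fin m) (Fin m) R) = φ :=
    Iff.rfl
  rw [h, ← Matrix.toBilin'.injective.eq_iff, ← Matrix.toBilin'_comp]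
  exact ⟨fun h x y => congrArg (fun B => B x y) h, fun h => LinearMap.ext₂ h⟩

lemma conj_mem_ESp {φ : Matrix (Fin (k + 1)) (Fin (k + 1)) R}
    {e f : Fin (k + 1) → R} (H : ElemPair (Matrix.toBilin' φ) e f (ESpEnd φ)) {h : R}
    (hh : 2 * h = 1) (hP : ElemPair.FullForm (Matrix.toBilin' φ) e f)
    {g y : GL (Fin (k + 1)) R} (hg : g ∈ Sp φ) {v z w : Fin (k + 1) → R} {a : R}
    (hz : Matrix.toBilin' φ v z = 1) (hw : Matrix.toBilin' φ v w = 0)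
    (hy : Matrix.toLin' (y : Matrix (Fin (k + 1)) (Fin (k + 1)) R) =
      transvec (Matrix.toBilin' φ) v w a) :
    g * y * g⁻¹ ∈ ESp φ := by
  have hiso := mem_Sp_iff.1 hg
  have hinv : Matrix.toLin' (g : Matrix (Fin (k + 1)) (Fin (k + 1)) R) *
      Matrix.toLin' ((g⁻¹ : GL (Fin (k + 1)) R) : Matrix (Fin (k + 1)) (Fin (k + 1)) R) = 1 := by
    rw [Module.End.mul_eq_comp, ← Matrix.toLin'_mul, Units.mul_inv, Matrix.toLin'_one]
    rfl
  have hconj := transvec_conj hiso v w a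
  rw [← toLin'_mem_ESpEnd, Units.val_mul, Units.val_mul, Matrix.toLin'_mul, Matrix.toLin'_mul, hy,
    ← Module.End.mul_eq_comp, ← Module.End.mul_eq_comp, hconj, mul_assoc, hinv, mul_one]
  exact H.transvec_mem hh hP ((hiso v z).trans hz) ((hiso v w).trans hw) a

end Transfer

end AltForm

theorem lemma5p1 {R : Type*} [CommRing R] (h2 : Ideal.span {(2 : R)} = ⊤)
    {n k : ℕ} (hn : 2 ≤ n) (hk : k + 1 = 2 * n)
    (φ : Matrix (Fin (k + 1)) (Fin (k + 1)) R)
    (hskew : φ.transpose = -φ) (hpf : AltForm.pfaffian (k + 1) φ = 1) :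
    AltForm.ESp φ ≤ AltForm.Sp φ ∧ ((AltForm.ESp φ).subgroupOf (AltForm.Sp φ)).Normal := by
  rw [Ideal.span_singleton_eq_top] at h2
  have hdet : IsUnit φ.det := by
    obtain ⟨m, rfl⟩ : ∃ m, k = m + 1 := ⟨k - 1, by omega⟩
    exact AltForm.isUnit_det_of_pfaffian h2 hskew hpf
  have H := AltForm.elemPair h2 hskew hdet
  have hP := AltForm.fullForm h2 hskew hdet (by omega)
  obtain ⟨h, hh⟩ := h2.exists_right_inv
  -- each generator is a transvection along one of the two vectors of the hyperbolic pair
  have gen : ∀ g : GL (Fin (k + 1)) R,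
      ((∃ v, (g : Matrix (Fin (k + 1)) (Fin (k + 1)) R) = AltForm.CMat φ v) ∨
        ∃ v, (g : Matrix (Fin (k + 1)) (Fin (k + 1)) R) = AltForm.RMat φ v) →
      ∃ v z w a, Matrix.toBilin' φ v z = 1 ∧ Matrix.toBilin' φ v w = 0 ∧
        Matrix.toLin' (g : Matrix (Fin (k + 1)) (Fin (k + 1)) R) =
          AltForm.transvec (Matrix.toBilin' φ) v w a := by
    rintro g (⟨v, hv⟩ | ⟨v, hv⟩)
    · refine ⟨_, _, _, _, H.pair, ?_, by rw [hv, AltForm.toLin'_CMat h2 hskew hdet v]⟩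
      rw [AltForm.toBilin'_pairF h2 hskew hdet]
    · refine ⟨_, -AltForm.pairF φ, _, _, ?_, ?_, by rw [hv, AltForm.toLin'_RMat h2 hskew hdet v]⟩
      · rw [map_neg, H.pair', neg_neg]
      rw [AltForm.toBilin'_pairE h2 hskew, dotProduct_neg, Matrix.dotProduct_mulVec,
        AltForm.cVec_vecMul_muMat h2 hskew hdet]
      simp
  have le : AltForm.ESp φ ≤ AltForm.Sp φ := by
    refine (Subgroup.closure_le _).2 fun g hg => AltForm.mem_Sp_iff.2 ?_
    obtain ⟨v, z, w, a, -, hw, hg⟩ := gen g hg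
    rw [hg]
    exact AltForm.transvec_isometry H.alt hw a
  refine ⟨le, ⟨fun x hx g => ?_⟩⟩
  rw [Subgroup.mem_subgroupOf] at hx ⊢
  suffices hle : AltForm.ESp φ ≤
      (AltForm.ESp φ).comap (MulAut.conj (g : GL (Fin (k + 1)) R)).toMonoidHom from hle hx
  refine (Subgroup.closure_le _).2 fun y hy => ?_
  obtain ⟨v, z, w, a, hz, hw, hg⟩ := gen y hy
  exact AltForm.conj_mem_ESp H hh hP g.2 hz hw hg
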